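/- Let $\mathbf{FI}$ be the category of finite sets and injections, let $k$ be a ring (for instance $k=\mathbb{Z}$), and let an $\mathbf{FI}$-module be a functor $V$ from $\mathbf{FI}$ to $k$-modules; write $V_n = V_{\{1,\dots,n\}}$. The degree $\deg(V)\in\{-1,0,1,\dots\}\cup\{\infty\}$ is the least $d\ge -1$ such that $V_S=0$ for every finite set $S$ with $|S|>d$. Let $\mathrm{H}^0_{\mathfrak m}$ be the left exact functor sending an $\mathbf{FI}$-module $V$ to its largest torsion $\mathbf{FI}$-submodule, that is, the submodule of those $x\in V_S$ that are sent to $0$ by the map $V_S\to V_T$ induced by some injection $S\to T$. For $j\ge 0$ let $\mathrm{H}^j_{\mathfrak m}=\mathrm{R}^j\mathrm{H}^0_{\mathfrak m}$ be its right derived functors (local cohomology) and put $h^j(V)=\deg(\mathrm{H}^j_{\mathfrak m}(V))$. Let $V$ be an $\mathbf{FI}$-module and $N\ge 0$ an integer, and let $V_{\ge N}$ be the unique $\mathbf{FI}$-submodule of $V$ with $(V_{\ge N})_n=0$ for $n<N$ and $(V_{\ge N})_n=V_n$ for $n\ge N$. Then \begin{itemize} \item $h^0(V_{\ge N})\le h^0(V)\le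 \max\{h^0(V_{\ge N}),\,N-1\}$, \item $h^1(V)\le h^1(V_{\ge N})\le \max\{N-1,\,h^1(V)\}$, \item $h^j(V)=h^j(V_{\ge N})$ for every $j\ge 2$. \end{itemize} -/

import Mathlib

open CategoryTheory CategoryTheory.Limits

universe u

/-- A finite set, as an object of the category `FI`. -/
structure FI where
  /-- the underlying set -/
  carrier : Type
  [finite : Finite carrier]

namespace FI

instance : CoeSort FI Type := ⟨FI.carrier⟩

instance (S : FI) : Finite S := S.finite

/-- The category of finite sets and injections. -/
instance : Category.{0} FI where
  Hom S T := S ↪ T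
  id S := Function.Embedding.refl S
  comp f g := f.trans g

/-- The standard finite set with `n` elements. -/
def std (n : ℕ) : FI := ⟨Fin n⟩

/-- The number of elements of a finite set. -/
noncomputable def card (S : FI) : ℕ := Nat.card S.carrier

theorem card_std (n : ℕ) : (std n).card = n := by simp [std, card]

theorem card_le {S T : FI} (f : S ⟶ T) : S.card ≤ T.card :=
  have f' : S.carrier ↪ T.carrier := f
  Nat.card_le_card_of_injective f' f'.injective

theorem exists_iso_std (S : FI) : Nonempty (S ≅ std S.card) := by
  let e : S.carrier ≃ Fin (Nat.card S.carrier) := Finite.equivFin S.carrier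
  exact ⟨{ hom := e.toEmbedding
           inv := e.symm.toEmbedding
           hom_inv_id := Function.Embedding.ext fun x => e.symm_apply_apply x
           inv_hom_id := Function.Embedding.ext fun x => e.apply_symm_apply x }⟩

/-- Two injections with the same source can be completed to a commutative square. -/
theorem exists_amalgam {S T U : FI} (f : S ⟶ T) (g : S ⟶ U) :
    ∃ (W : FI) (a : T ⟶ W) (b : U ⟶ W), f ≫ a = g ≫ b := by
  classical
  let f' : S.carrier ↪ T.carrier := f
  let g' : S.carrier ↪ U.carrier := g
  let a : T.carrier → U.carrier ⊕ T.carrier := fun t =>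
    if h : ∃ s, f' s = t then Sum.inl (g' h.choose) else Sum.inr t
  have ha : Function.Injective a := by
    intro t t' h
    by_cases h1 : ∃ s, f' s = t <;> by_cases h2 : ∃ s, f' s = t'
    · simp only [a, h1, h2, dif_pos, Sum.inl.injEq] at h
      rw [← h1.choose_spec, ← h2.choose_spec, g'.injective h]
    · simp [a, dif_pos h1, dif_neg h2] at h
    · simp [a, dif_neg h1, dif_pos h2] at h
    · simpa only [a, dif_neg h1, dif_neg h2, Sum.inr.injEq] using h
  refine ⟨⟨U.carrier ⊕ T.carrier⟩, (⟨a, ha⟩ : T.carrier ↪ U.carrier ⊕ T.carrier),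
    (⟨Sum.inl, Sum.inl_injective⟩ : U.carrier ↪ U.carrier ⊕ T.carrier), ?_⟩
  refine Function.Embedding.ext fun s => ?_
  change a (f' s) = Sum.inl (g' s)
  have h : ∃ s', f' s' = f' s := ⟨s, rfl⟩
  simp only [a, dif_pos h]
  rw [f'.injective h.choose_spec]

end FI

/-- `FI`-modules over the ring `k`: functors from `FI` to `k`-modules. -/
abbrev FIMod (k : Type u) [Ring k] := FI ⥤ ModuleCat.{u} k

namespace FIMod

variable {k : Type u} [Ring k]

/-- An `FI`-submodule of `V`: a family of submodules of the `V_S` that is preserved by all the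
structure maps. -/
@[ext]
structure Sub (V : FIMod k) where
  /-- the submodule of `V_S` -/
  carrier : ∀ S : FI, Submodule k (V.obj S)
  map_mem : ∀ {S T : FI} (f : S ⟶ T) (x : V.obj S), x ∈ carrier S → V.map f x ∈ carrier T

/-- An `FI`-submodule, as an `FI`-module in its own right. -/
def Sub.toFIMod {V : FIMod k} (U : V.Sub) : FIMod k where
  obj S := ModuleCat.of k (U.carrier S)
  map {S T} f := ModuleCat.ofHom ((V.map f).hom.restrict (p := U.carrier S) (q := U.carrier T)
    fun x hx => U.map_mem f x hx)
  map_id S := by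
    ext x
    change V.map (𝟙 S) x.1 = x.1
    simp
  map_comp {S T W} f g := by
    ext x
    change V.map (f ≫ g) x.1 = V.map g (V.map f x.1)
    simp

/-- The truncation `V_{≥ N}`: the `FI`-submodule of `V` which is `V_S` for `|S| ≥ N` and `0` for
`|S| < N`. -/
noncomputable def truncSub (V : FIMod k) (N : ℕ) : V.Sub where
  carrier S := if N ≤ S.card then ⊤ else ⊥
  map_mem {S T} f x hx := by
    by_cases h1 : N ≤ S.card
    · rw [if_pos (h1.trans (FI.card_le f))]
      trivial
    · rw [if_neg h1, Submodule.mem_bot] at hx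
      rw [hx, map_zero]
      exact Submodule.zero_mem _

/-- The truncation `V_{≥ N}` as an `FI`-module. -/
noncomputable def trunc (V : FIMod k) (N : ℕ) : FIMod k := (V.truncSub N).toFIMod

theorem truncSub_unique (V : FIMod k) (N : ℕ) (U : V.Sub)
    (h0 : ∀ n < N, U.carrier (FI.std n) = ⊥) (h1 : ∀ n ≥ N, U.carrier (FI.std n) = ⊤) :
    U = V.truncSub N := by
  have key : ∀ {S T : FI} (e : S ≅ T) (x : V.obj S),
      V.map e.hom x ∈ U.carrier T → x ∈ U.carrier S := by
    intro S T e x hx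
    have h := U.map_mem e.inv _ hx
    rwa [← ModuleCat.comp_apply, ← V.map_comp, e.hom_inv_id, V.map_id] at h
  ext S x
  obtain ⟨e⟩ := S.exists_iso_std
  simp only [truncSub]
  split_ifs with h
  · refine iff_of_true (key e x ?_) trivial
    rw [h1 _ h]
    trivial
  · rw [Submodule.mem_bot]
    refine ⟨fun hx => ?_, fun hx => hx ▸ Submodule.zero_mem _⟩
    have h2 := U.map_mem e.hom x hx
    rw [h0 _ (not_le.mp h), Submodule.mem_bot] at h2
    have h3 : V.map e.inv (V.map e.hom x) = x := by
      rw [← ModuleCat.comp_apply, ← V.map_comp, e.hom_inv_id, V.map_id]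
      rfl
    rw [← h3, h2, map_zero]

/-- The largest torsion `FI`-submodule of `V`: it consists of the `x ∈ V_S` that are sent to `0`
by the map `V_S → V_T` induced by some injection `S → T`. -/
def torsionSub (V : FIMod k) : V.Sub where
  carrier S :=
    { carrier := {x | ∃ (T : FI) (f : S ⟶ T), V.map f x = 0}
      zero_mem' := ⟨S, 𝟙 S, map_zero _⟩
      add_mem' := by
        rintro x y ⟨T, f, hf⟩ ⟨T', g, hg⟩
        obtain ⟨W, a, b, hab⟩ := FI.exists_amalgam f g
        refine ⟨W, f ≫ a, ?_⟩
        rw [map_add]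
        nth_rewrite 2 [hab]
        simp [hf, hg]
      smul_mem' := by
        rintro c x ⟨T, f, hf⟩
        exact ⟨T, f, by rw [map_smul, hf, smul_zero]⟩ }
  map_mem := by
    rintro S T f x ⟨U, g, hg⟩
    obtain ⟨W, a, b, hab⟩ := FI.exists_amalgam f g
    refine ⟨W, a, ?_⟩
    rw [← ModuleCat.comp_apply, ← V.map_comp, hab]
    simp [hg]

/-- The functor `H⁰_𝔪`, which sends an `FI`-module to its largest torsion `FI`-submodule. -/
def torsion (k : Type u) [Ring k] : FIMod k ⥤ FIMod k where
  obj V := V.torsionSub.toFIMod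
  map {V W} φ :=
    { app S := ModuleCat.ofHom ((φ.app S).hom.restrict
        (p := V.torsionSub.carrier S) (q := W.torsionSub.carrier S) (by
          rintro x ⟨T, f, hf⟩
          refine ⟨T, f, ?_⟩
          have h : W.map f (φ.app S x) = φ.app T (V.map f x) := by
            rw [← ModuleCat.comp_apply, ← ModuleCat.comp_apply, φ.naturality]
          exact h.trans (by rw [hf, map_zero])))
      naturality S T f := by
        ext x
        apply Subtype.ext
        change φ.app T (V.map f x.1) = W.map f (φ.app S x.1)
        rw [← ModuleCat.comp_apply, ← ModuleCat.comp_apply, φ.naturality] }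
  map_id V := rfl
  map_comp φ ψ := rfl

instance torsion_additive (k : Type u) [Ring k] : (torsion k).Additive where
  map_add := rfl

/-- The category of `FI`-modules has enough injectives. -/
instance enoughInjectives (k : Type u) [Ring k] : EnoughInjectives (FIMod k) where
  presentation V := by
    let J : ℕ → FIMod k := fun n =>
      (evaluationRightAdjoint (ModuleCat.{u} k) (FI.std n)).obj
        (Injective.under (V.obj (FI.std n)))
    have hJ : ∀ n, Injective (J n) := fun n =>
      Injective.injective_of_adjoint (evaluationAdjunctionLeft (ModuleCat.{u} k) (FI.std n)) _
    let ι : ∀ n, V ⟶ J n := fun n =>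
      (evaluationAdjunctionLeft (ModuleCat.{u} k) (FI.std n)).homEquiv V _
        (Injective.ι (V.obj (FI.std n)))
    have hι : ∀ n, Mono ((ι n).app (FI.std n)) := fun n => by
      have h := (evaluationAdjunctionLeft (ModuleCat.{u} k) (FI.std n)).homEquiv_counit
        (g := ι n)
      have h' : (ι n).app (FI.std n) ≫ (evaluationAdjunctionLeft (ModuleCat.{u} k)
          (FI.std n)).counit.app (Injective.under (V.obj (FI.std n))) =
          Injective.ι (V.obj (FI.std n)) := by
        rw [← (Equiv.symm_apply_apply ((evaluationAdjunctionLeft (ModuleCat.{u} k)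
          (FI.std n)).homEquiv V _) (Injective.ι (V.obj (FI.std n)))), h]
        rfl
      have : Mono ((ι n).app (FI.std n) ≫ (evaluationAdjunctionLeft (ModuleCat.{u} k)
          (FI.std n)).counit.app (Injective.under (V.obj (FI.std n)))) := by
        rw [h']; infer_instance
      exact mono_of_mono _ ((evaluationAdjunctionLeft (ModuleCat.{u} k)
          (FI.std n)).counit.app (Injective.under (V.obj (FI.std n))))
    have hm : Mono (Pi.lift ι) := by
      have : ∀ S, Mono ((Pi.lift ι).app S) := by
        intro S
        obtain ⟨e⟩ := S.exists_iso_std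
        have h1 : (Pi.lift ι).app S ≫ (Pi.π J S.card).app S = (ι S.card).app S := by
          rw [← NatTrans.comp_app, Pi.lift_π]
        have h2 : (ι S.card).app S = V.map e.hom ≫ (ι S.card).app (FI.std S.card) ≫
            (J S.card).map e.inv := by
          rw [← (ι S.card).naturality, ← V.map_comp_assoc, e.hom_inv_id, V.map_id,
            Category.id_comp]
        have h3 : Mono ((Pi.lift ι).app S ≫ (Pi.π J S.card).app S) := by
          rw [h1, h2]; infer_instance
        exact mono_of_mono _ ((Pi.π J S.card).app S)
      exact NatTrans.mono_of_mono_app _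
    exact ⟨{ J := ∏ᶜ J, injective := inferInstance, f := Pi.lift ι, mono := hm }⟩

/-- The local cohomology functors `H^j_𝔪`, the right derived functors of `H⁰_𝔪`. -/
noncomputable def locoh (k : Type u) [Ring k] (j : ℕ) : FIMod k ⥤ FIMod k :=
  (torsion k).rightDerived j

/-- The degree of an `FI`-module, in `{-1, 0, 1, …} ∪ {∞}`: the least `d ≥ -1` such that `V_S = 0`
for all finite sets `S` with more than `d` elements. -/
noncomputable def degree (V : FIMod k) : WithTop ℤ :=
  sInf {d | ((-1 : ℤ) : WithTop ℤ) ≤ d ∧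
    ∀ S : FI, d < ((S.card : ℤ) : WithTop ℤ) → Subsingleton (V.obj S)}

/-- The local cohomology degrees `h^j(V) = deg H^j_𝔪(V)`. -/
noncomputable def locohDegree (j : ℕ) (V : FIMod k) : WithTop ℤ :=
  degree ((locoh k j).obj V)

theorem degree_le_iff (V : FIMod k) (d : WithTop ℤ) :
    V.degree ≤ d ↔ ((-1 : ℤ) : WithTop ℤ) ≤ d ∧
      ∀ S : FI, d < ((S.card : ℤ) : WithTop ℤ) → Subsingleton (V.obj S) := by
  set A : Set (WithTop ℤ) := {d | ((-1 : ℤ) : WithTop ℤ) ≤ d ∧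
    ∀ S : FI, d < ((S.card : ℤ) : WithTop ℤ) → Subsingleton (V.obj S)} with hA
  have hb : BddBelow A := ⟨((-1 : ℤ) : WithTop ℤ), fun d hd => hd.1⟩
  have hne : A.Nonempty := ⟨⊤, le_top, fun S h => absurd h not_top_lt⟩
  constructor
  · intro h
    refine ⟨(le_csInf hne fun d hd => hd.1).trans h, fun S hS => ?_⟩
    obtain ⟨e, he, hlt⟩ := exists_lt_of_csInf_lt hne (h.trans_lt hS)
    exact he.2 S hlt
  · intro h
    exact csInf_le hb h

end FIMod

/-! The quotient `Q = V / V_{≥ N}` vanishes on sets of size at least `N`. Every element of such a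
module is torsion, because every finite set injects into arbitrarily large ones. So `H⁰_𝔪` returns
`Q` itself, and `Q` should have no higher local cohomology. The long exact sequence of `0 → V_{≥ N}
→ V → Q → 0` would then reduce to `0 → H⁰(V_{≥ N}) → H⁰(V) → Q → H¹(V_{≥ N}) → H¹(V) → 0` and
isomorphisms in degrees at least two. Since `Q_S = 0` for `|S| > N - 1`, the inequalities follow.

The proof obtains these consequences without a full long exact sequence. Modules vanishing from size
`N` on are stable under quotients, embed into injectives of the same kind
(`VanishesFrom.exists_injective`), and `H⁰_𝔪` preserves epimorphisms out of them. For a left exact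
`F` and a class with these properties, `exists_shortExact_rightDerived` embeds a short exact
sequence into a split sequence of injectives whose third term is in the class. The snake lemma gives
the low-degree exact sequence, and the quotient sequence shifts the higher derived functors down by
one. Induction then gives the isomorphisms in degrees at least two. They are only asserted to exist,
which suffices for comparing degrees. -/

namespace CategoryTheory

/-! ### Dimension shifting along a short exact sequence with injective middle term -/

section

variable {C D : Type*} [Category* C] [Abelian C] [Category* D] [Abelian D]

/-- The augmentation of an injective resolution of `X`, as a morphism from `X`. -/
noncomputable def InjectiveResolution.augmentation {X : C} (R : InjectiveResolution X) :
    X ⟶ R.cocomplex.X 0 :=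
  R.ι.f 0

instance {X : C} (R : InjectiveResolution X) : Mono R.augmentation :=
  inferInstanceAs (Mono (R.ι.f 0))

@[simp]
theorem InjectiveResolution.augmentation_d {X : C} (R : InjectiveResolution X) :
    R.augmentation ≫ R.cocomplex.d 0 1 = 0 :=
  R.ι_f_zero_comp_complex_d

/-- An injective resolution of `S.X₃` can be spliced with a short exact sequence whose middle term
is injective, to give an injective resolution of `S.X₁`. -/
noncomputable def InjectiveResolution.cons {S : ShortComplex C} (hS : S.ShortExact)
    [Injective S.X₂] (R : InjectiveResolution S.X₃) : InjectiveResolution S.X₁ where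
  cocomplex := R.cocomplex.augment (S.g ≫ R.augmentation)
    (by rw [Category.assoc, R.augmentation_d, comp_zero])
  injective n := by
    cases n
    · exact inferInstanceAs (Injective S.X₂)
    · exact R.injective _
  ι := (CochainComplex.fromSingle₀Equiv _ _).symm ⟨S.f, by
    have h : S.f ≫ S.g ≫ R.augmentation = 0 := by rw [S.zero_assoc, zero_comp]
    exact h⟩
  quasiIso := ⟨fun n => by
    have := hS.mono_f
    have := hS.epi_g
    cases n with
    | zero =>
      rw [CochainComplex.quasiIsoAt₀_iff, ShortComplex.quasiIso_iff_of_zeros]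
      -- The augmentation is mono, so composing with it does not change the kernel of `S.g`.
      · let φ : S ⟶ ShortComplex.mk S.f (S.g ≫ R.augmentation) (by rw [S.zero_assoc, zero_comp]) :=
          { τ₁ := 𝟙 _
            τ₂ := 𝟙 _
            τ₃ := R.augmentation }
        have : Mono φ.τ₃ := inferInstanceAs (Mono R.augmentation)
        have h : ((CochainComplex.fromSingle₀Equiv (R.cocomplex.augment (S.g ≫ R.augmentation)
            (by rw [Category.assoc, R.augmentation_d, comp_zero])) S.X₁).symm ⟨S.f, by
              have h : S.f ≫ S.g ≫ R.augmentation = 0 := by rw [S.zero_assoc, zero_comp]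
              exact h⟩).f 0 = S.f := CochainComplex.fromSingle₀Equiv_symm_apply_f_zero _ _
        refine (ShortComplex.exact_and_mono_f_iff_of_iso ?_).1
          ⟨(ShortComplex.exact_iff_of_epi_of_isIso_of_mono φ).1 hS.exact, hS.mono_f⟩
        exact ShortComplex.isoMk (Iso.refl _) (Iso.refl _) (Iso.refl _)
          ((Category.id_comp _).trans (h.trans (Category.comp_id _).symm))
          ((Category.id_comp _).trans (Category.comp_id _).symm)
      all_goals rfl
    | succ n =>
      rw [quasiIsoAt_iff_exactAt]
      · cases n with
        | zero =>
          rw [HomologicalComplex.exactAt_iff' _ 0 1 2 (by simp) (by simp)]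
          -- `S.g` is epi, so the spliced differential has the same image as the augmentation.
          let φ : ShortComplex.mk (S.g ≫ R.augmentation) (R.cocomplex.d 0 1)
              (by rw [Category.assoc, R.augmentation_d, comp_zero]) ⟶
              ShortComplex.mk _ _ R.augmentation_d :=
            { τ₁ := S.g
              τ₂ := 𝟙 _
              τ₃ := 𝟙 _ }
          have : Epi φ.τ₁ := hS.epi_g
          exact (ShortComplex.exact_iff_of_epi_of_isIso_of_mono φ).2 R.exact₀
        | succ n =>
          rw [HomologicalComplex.exactAt_iff' _ (n + 1) (n + 2) (n + 3) (by simp) (by simp)]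
          exact R.exact_succ n
      · apply CochainComplex.exactAt_succ_single_obj⟩

variable (F : C ⥤ D) [F.Additive]

/-- Dimension shifting for right derived functors. -/
theorem nonempty_rightDerived_iso_of_shortExact [HasInjectiveResolutions C] {S : ShortComplex C}
    (hS : S.ShortExact) [Injective S.X₂] (n : ℕ) :
    Nonempty ((F.rightDerived (n + 2)).obj S.X₁ ≅ (F.rightDerived (n + 1)).obj S.X₃) := by
  let R := injectiveResolution S.X₃
  refine ⟨(R.cons hS).isoRightDerivedObj F (n + 2) ≪≫ ?_ ≪≫
    (R.isoRightDerivedObj F (n + 1)).symm⟩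
  let K := (F.mapHomologicalComplex _).obj R.cocomplex
  let K' := (F.mapHomologicalComplex _).obj (R.cons hS).cocomplex
  -- All three terms lie beyond the splice, where the new complex is the old one moved by one
  -- degree.
  exact K'.homologyIsoSc' (n + 1) (n + 2) (n + 3) (by simp) (by simp) ≪≫
    ShortComplex.homologyMapIso (ShortComplex.isoMk (S₁ := K'.sc' (n + 1) (n + 2) (n + 3))
      (S₂ := K.sc' n (n + 1) (n + 2)) (Iso.refl _) (Iso.refl _) (Iso.refl _)
      ((Category.id_comp _).trans (Category.comp_id _).symm)
      ((Category.id_comp _).trans (Category.comp_id _).symm)) ≪≫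
    (K.homologyIsoSc' n (n + 1) (n + 2) (by simp) (by simp)).symm

/-- The first right derived functor as a cokernel. -/
theorem nonempty_rightDerived_one_iso_of_shortExact [PreservesFiniteLimits F]
    [HasInjectiveResolutions C] {S : ShortComplex C} (hS : S.ShortExact) [Injective S.X₂] :
    Nonempty ((F.rightDerived 1).obj S.X₁ ≅ cokernel (F.map S.g)) := by
  let R := injectiveResolution S.X₃
  refine ⟨(R.cons hS).isoRightDerivedObj F 1 ≪≫
    HomologicalComplex.homologyIsoSc' _ 0 1 2 (by simp) (by simp) ≪≫ ?_⟩
  let K := ((F.mapHomologicalComplex _).obj (R.cons hS).cocomplex).sc' 0 1 2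
  have wi : F.map R.augmentation ≫ F.map (R.cocomplex.d 0 1) = 0 := by
    rw [← F.map_comp, R.augmentation_d, F.map_zero]
  -- By left exactness the cocycles in degree one are `F.obj S.X₃`, so only the image of `F.map S.g`
  -- is divided out.
  have hi : IsLimit (KernelFork.ofι (F.map R.augmentation) wi) :=
    KernelFork.mapIsLimit _ R.isLimitKernelFork F
  have hK : F.map (S.g ≫ R.augmentation) ≫ F.map (R.cocomplex.d 0 1) = 0 := K.zero
  have hf : hi.lift (KernelFork.ofι _ hK) = F.map S.g := by
    refine Fork.IsLimit.hom_ext hi ((hi.fac _ WalkingParallelPair.zero).trans ?_)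
    exact F.map_comp _ _
  have wπ : hi.lift (KernelFork.ofι _ hK) ≫ cokernel.π (F.map S.g) = 0 := by
    rw [hf, cokernel.condition]
  let h : K.LeftHomologyData :=
    { K := F.obj S.X₃
      H := cokernel (F.map S.g)
      i := F.map R.augmentation
      π := cokernel.π _
      wi := wi
      hi := hi
      wπ := wπ
      hπ := CokernelCofork.IsColimit.ofπ _ _
        (fun x hx => cokernel.desc _ x (by rw [← hf]; exact hx))
        (fun x hx => cokernel.π_desc _ _ _)
        (fun x hx b hb => coequalizer.hom_ext (by rw [hb, cokernel.π_desc])) }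
  exact h.homologyIso

end

end CategoryTheory

/-! ### Snake diagrams for a monomorphism of short exact sequences -/

namespace CategoryTheory

section

variable {C D : Type*} [Category* C] [Abelian C] [Category* D] [Abelian D]

namespace ShortComplex

theorem mono_of_mono_components {S T : ShortComplex C} (φ : S ⟶ T) [Mono φ.τ₁]
    [Mono φ.τ₂] [Mono φ.τ₃] : Mono φ where
  right_cancellation a b h := by
    ext
    · rw [← cancel_mono φ.τ₁, ← comp_τ₁, h, comp_τ₁]
    · rw [← cancel_mono φ.τ₂, ← comp_τ₂, h, comp_τ₂]
    · rw [← cancel_mono φ.τ₃, ← comp_τ₃, h, comp_τ₃]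

open ZeroObject in
/-- The snake diagram of a monomorphism between short exact sequences. -/
noncomputable def cokernelSnakeInput {S T : ShortComplex C} (φ : S ⟶ T)
    [Mono φ] (hS : S.ShortExact) (hT : T.ShortExact) : SnakeInput C where
  L₀ := ShortComplex.mk (0 : (0 : C) ⟶ 0) (0 : (0 : C) ⟶ 0) zero_comp
  L₁ := S
  L₂ := T
  L₃ := cokernel φ
  v₀₁ := 0
  v₁₂ := φ
  v₂₃ := cokernel.π φ
  w₀₂ := zero_comp
  w₁₃ := cokernel.condition φ
  h₀ := KernelFork.IsLimit.ofMonoOfIsZero _ inferInstance (by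
    refine (IsZero.iff_id_eq_zero _).2 ?_
    ext <;> exact (isZero_zero C).eq_of_src _ _)
  h₃ := cokernelIsCokernel φ
  L₁_exact := hS.exact
  epi_L₁_g := hS.epi_g
  L₂_exact := hT.exact
  mono_L₂_f := hT.mono_f

/-- The cokernel of a monomorphism between short exact sequences is short exact. -/
theorem ShortExact.cokernel {S T : ShortComplex C} (φ : S ⟶ T)
    [Mono φ] (hS : S.ShortExact) (hT : T.ShortExact) : (cokernel φ).ShortExact := by
  let I := cokernelSnakeInput φ hS hT
  have : Epi I.L₂.g := hT.epi_g
  exact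
    { exact := I.L₃_exact
      mono_f := I.L₂'_exact.mono_g ((isZero_zero C).eq_of_src _ _)
      epi_g := inferInstanceAs (Epi I.L₃.g) }

section

variable {S T : ShortComplex C} (φ : S ⟶ T) [Mono φ]

/-- The first column of the diagram formed by a morphism of short complexes and its cokernel. -/
noncomputable abbrev cokernelColumn₁ : ShortComplex C :=
  ShortComplex.mk φ.τ₁ (cokernel.π φ).τ₁ (by rw [← comp_τ₁, cokernel.condition, zero_τ₁])

/-- The second column of the diagram formed by a morphism of short complexes and its cokernel. -/
noncomputable abbrev cokernelColumn₂ : ShortComplex C :=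
  ShortComplex.mk φ.τ₂ (cokernel.π φ).τ₂ (by rw [← comp_τ₂, cokernel.condition, zero_τ₂])

/-- The third column of the diagram formed by a morphism of short complexes and its cokernel. -/
noncomputable abbrev cokernelColumn₃ : ShortComplex C :=
  ShortComplex.mk φ.τ₃ (cokernel.π φ).τ₃ (by rw [← comp_τ₃, cokernel.condition, zero_τ₃])

theorem cokernelColumn₁_shortExact : (cokernelColumn₁ φ).ShortExact where
  exact := exact_of_g_is_cokernel _
    (isColimitCoforkMapOfIsColimit' π₁ (cokernel.condition φ) (cokernelIsCokernel φ))
  mono_f := inferInstanceAs (Mono (π₁.map φ))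
  epi_g := inferInstanceAs (Epi (π₁.map (cokernel.π φ)))

theorem cokernelColumn₂_shortExact : (cokernelColumn₂ φ).ShortExact where
  exact := exact_of_g_is_cokernel _
    (isColimitCoforkMapOfIsColimit' π₂ (cokernel.condition φ) (cokernelIsCokernel φ))
  mono_f := inferInstanceAs (Mono (π₂.map φ))
  epi_g := inferInstanceAs (Epi (π₂.map (cokernel.π φ)))

theorem cokernelColumn₃_shortExact : (cokernelColumn₃ φ).ShortExact where
  exact := exact_of_g_is_cokernel _
    (isColimitCoforkMapOfIsColimit' π₃ (cokernel.condition φ) (cokernelIsCokernel φ))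
  mono_f := inferInstanceAs (Mono (π₃.map φ))
  epi_g := inferInstanceAs (Epi (π₃.map (cokernel.π φ)))

end

section

variable (F : C ⥤ D) [F.Additive] [PreservesFiniteLimits F] {S T : ShortComplex C} (φ : S ⟶ T)
  [Mono φ]

/-- The snake diagram obtained by applying a left exact functor to a monomorphism from a short exact
sequence to a split one, and to its cokernel. -/
noncomputable def mapCokernelSnakeInput (hS : S.ShortExact) (hT : T.Splitting) :
    SnakeInput D where
  L₀ := F.mapShortComplex.obj S
  L₁ := F.mapShortComplex.obj T
  L₂ := F.mapShortComplex.obj (cokernel φ)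
  L₃ := cokernel (F.mapShortComplex.map (cokernel.π φ))
  v₀₁ := F.mapShortComplex.map φ
  v₁₂ := F.mapShortComplex.map (cokernel.π φ)
  v₂₃ := cokernel.π _
  w₀₂ := by rw [← Functor.map_comp, cokernel.condition]; ext <;> exact F.map_zero _ _
  w₁₃ := cokernel.condition _
  -- Kernels of short complexes are computed termwise, and `F` preserves the kernel in each column.
  h₀ := isLimitOfIsLimitπ _
    ((KernelFork.isLimitMapConeEquiv _ π₁).symm
      (KernelFork.mapIsLimit _ (cokernelColumn₁_shortExact φ).fIsKernel F))
    ((KernelFork.isLimitMapConeEquiv _ π₂).symm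
      (KernelFork.mapIsLimit _ (cokernelColumn₂_shortExact φ).fIsKernel F))
    ((KernelFork.isLimitMapConeEquiv _ π₃).symm
      (KernelFork.mapIsLimit _ (cokernelColumn₃_shortExact φ).fIsKernel F))
  h₃ := cokernelIsCokernel _
  L₁_exact := (hT.map F).exact
  epi_L₁_g := (hT.map F).epi_g
  L₂_exact := by
    have h := hS.cokernel φ hT.shortExact
    exact ((Functor.preservesFiniteLimits_iff_forall_exact_map_and_mono F).1 inferInstance _ h).1
  mono_L₂_f := by
    have h := hS.cokernel φ hT.shortExact
    exact ((Functor.preservesFiniteLimits_iff_forall_exact_map_and_mono F).1 inferInstance _ h).2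

end

end ShortComplex

/-! ### Comparison of derived functors along a short exact sequence -/

variable (F : C ⥤ D) [F.Additive] [PreservesFiniteLimits F] [EnoughInjectives C]

/-- The column has an injective middle term, so its cokernel after `F` computes the first derived
functor; cokernels of short complexes are taken termwise. -/
theorem ShortComplex.cokernelColumn₁_nonempty_iso {S T : ShortComplex C} (φ : S ⟶ T) [Mono φ]
    [Injective T.X₁] : Nonempty ((F.rightDerived 1).obj S.X₁ ≅
      (cokernel (F.mapShortComplex.map (cokernel.π φ))).X₁) := by
  have : Injective (cokernelColumn₁ φ).X₂ := inferInstanceAs (Injective T.X₁)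
  obtain ⟨e⟩ := nonempty_rightDerived_one_iso_of_shortExact F (cokernelColumn₁_shortExact φ)
  exact ⟨e ≪≫ (PreservesCokernel.iso π₁ (F.mapShortComplex.map (cokernel.π φ))).symm⟩

theorem ShortComplex.cokernelColumn₂_nonempty_iso {S T : ShortComplex C} (φ : S ⟶ T) [Mono φ]
    [Injective T.X₂] : Nonempty ((F.rightDerived 1).obj S.X₂ ≅
      (cokernel (F.mapShortComplex.map (cokernel.π φ))).X₂) := by
  have : Injective (cokernelColumn₂ φ).X₂ := inferInstanceAs (Injective T.X₂)
  obtain ⟨e⟩ := nonempty_rightDerived_one_iso_of_shortExact F (cokernelColumn₂_shortExact φ)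
  exact ⟨e ≪≫ (PreservesCokernel.iso π₂ (F.mapShortComplex.map (cokernel.π φ))).symm⟩

/-- One step of the comparison of the derived functors along a short exact sequence, when the third
term embeds into an injective object all of whose quotient maps are preserved by `F`. -/
theorem exists_shortExact_rightDerived {S : ShortComplex C} (hS : S.ShortExact)
    {L : C} [Injective L] (c : S.X₃ ⟶ L) [Mono c]
    (hL : ∀ {X : C} (p : L ⟶ X) [Epi p], Epi (F.map p)) :
    ∃ (S' : ShortComplex C) (p : L ⟶ S'.X₃), S'.ShortExact ∧ Epi p ∧ Epi (F.map S'.g) ∧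
      (∀ n, Nonempty ((F.rightDerived (n + 2)).obj S.X₁ ≅ (F.rightDerived (n + 1)).obj S'.X₁)) ∧
      (∀ n, Nonempty ((F.rightDerived (n + 2)).obj S.X₂ ≅ (F.rightDerived (n + 1)).obj S'.X₂)) ∧
      ∃ (δ : F.obj S.X₃ ⟶ (F.rightDerived 1).obj S.X₁)
        (f : (F.rightDerived 1).obj S.X₁ ⟶ (F.rightDerived 1).obj S.X₂)
        (w : F.map S.g ≫ δ = 0) (w' : δ ≫ f = 0),
        (ShortComplex.mk _ _ w).Exact ∧ (ShortComplex.mk _ _ w').Exact ∧ Epi f := by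
  have := hS.mono_f
  let T : ShortComplex C := ShortComplex.mk (biprod.inl : Injective.under S.X₁ ⟶ _)
    (biprod.snd : _ ⟶ L) (by simp)
  let σ : T.Splitting := ShortComplex.Splitting.ofHasBinaryBiproduct _ _
  let φ : S ⟶ T :=
    { τ₁ := Injective.ι S.X₁
      τ₂ := biprod.lift (Injective.factorThru (Injective.ι S.X₁) S.f) (S.g ≫ c)
      τ₃ := c
      comm₁₂ := by
        ext
        · simp [T]
        · simp [T] }
  have : Mono φ.τ₁ := inferInstanceAs (Mono (Injective.ι S.X₁))
  have : Mono φ.τ₃ := inferInstanceAs (Mono c)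
  have : Mono T.f := σ.shortExact.mono_f
  have : Mono φ.τ₂ := ShortComplex.mono_τ₂_of_exact_of_mono φ hS.exact
  have : Mono φ := ShortComplex.mono_of_mono_components φ
  have : Injective T.X₁ := inferInstanceAs (Injective (Injective.under S.X₁))
  have : Injective T.X₂ := inferInstanceAs (Injective (Injective.under S.X₁ ⊞ L))
  have : Injective (ShortComplex.cokernelColumn₁ φ).X₂ := inferInstanceAs (Injective T.X₁)
  have : Injective (ShortComplex.cokernelColumn₂ φ).X₂ := inferInstanceAs (Injective T.X₂)
  let p : L ⟶ (cokernel φ).X₃ := (cokernel.π φ).τ₃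
  have hp : Epi p := (ShortComplex.cokernelColumn₃_shortExact φ).epi_g
  have hFp : Epi (F.map p) := hL p
  have hFT : Epi (F.map T.g) := (σ.map F).epi_g
  -- The composite `F.map T.g ≫ F.map p` is epi and factors through this map.
  have hFg : Epi (F.map (cokernel φ).g) := by
    have h : F.map (cokernel.π φ).τ₂ ≫ F.map (cokernel φ).g = F.map T.g ≫ F.map p := by
      rw [← F.map_comp, ← F.map_comp, (cokernel.π φ).comm₂₃]
    have : Epi (F.map (cokernel.π φ).τ₂ ≫ F.map (cokernel φ).g) := by
      rw [h]
      exact epi_comp _ _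
    exact epi_of_epi (F.map (cokernel.π φ).τ₂) _
  let I := ShortComplex.mapCokernelSnakeInput F φ hS σ
  obtain ⟨e₁⟩ : Nonempty ((F.rightDerived 1).obj S.X₁ ≅ I.L₃.X₁) :=
    ShortComplex.cokernelColumn₁_nonempty_iso F φ
  obtain ⟨e₂⟩ : Nonempty ((F.rightDerived 1).obj S.X₂ ≅ I.L₃.X₂) :=
    ShortComplex.cokernelColumn₂_nonempty_iso F φ
  -- The third entry of the cokernel row is the cokernel of the epimorphism `F.map p`, so it
  -- contributes nothing.
  have hg : I.L₃.g = 0 := by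
    have : Epi I.v₁₂.τ₃ := hFp
    have h : I.v₂₃.τ₃ = 0 := by
      rw [← cancel_epi I.v₁₂.τ₃, I.w₁₃_τ₃, comp_zero]
    rw [← cancel_epi I.v₂₃.τ₂, I.v₂₃.comm₂₃, h, comp_zero, comp_zero]
  have : Epi I.L₃.f := I.L₃_exact.epi_f hg
  have w : I.L₀.g ≫ I.δ ≫ e₁.inv = 0 := by rw [← Category.assoc, I.L₀_g_δ, zero_comp]
  have w' : (I.δ ≫ e₁.inv) ≫ e₁.hom ≫ I.L₃.f ≫ e₂.inv = 0 := by
    rw [Category.assoc, e₁.inv_hom_id_assoc, ← Category.assoc, I.δ_L₃_f, zero_comp]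
  refine ⟨cokernel φ, p, hS.cokernel φ σ.shortExact, hp, hFg,
    nonempty_rightDerived_iso_of_shortExact F (ShortComplex.cokernelColumn₁_shortExact φ),
    nonempty_rightDerived_iso_of_shortExact F (ShortComplex.cokernelColumn₂_shortExact φ),
    I.δ ≫ e₁.inv, e₁.hom ≫ I.L₃.f ≫ e₂.inv, w, w', ?_, ?_, inferInstance⟩
  · exact ShortComplex.exact_of_iso (ShortComplex.isoMk (S₁ := I.L₁') (Iso.refl _) (Iso.refl _)
      e₁.symm ((Category.id_comp _).trans (Category.comp_id _).symm) (Category.id_comp _))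
      I.L₁'_exact
  · refine ShortComplex.exact_of_iso (ShortComplex.isoMk (S₁ := I.L₂') (Iso.refl _) e₁.symm
      e₂.symm (Category.id_comp _) ?_) I.L₂'_exact
    exact e₁.inv_hom_id_assoc _

/-- Let `P` be a class of objects that is stable under quotients, such that `F` preserves
epimorphisms out of objects in `P` and every object in `P` embeds into an injective object
in `P`. Then the higher derived functors of `F` do not distinguish the first two terms of a short
exact sequence whose third term is in `P`, as soon as `F` preserves the epimorphism in it. -/
theorem nonempty_rightDerived_iso_of_epi (P : C → Prop)
    (hquot : ∀ {X Y : C} (p : X ⟶ Y) [Epi p], P X → P Y)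
    (hepi : ∀ {X Y : C} (p : X ⟶ Y) [Epi p], P X → Epi (F.map p))
    (hinj : ∀ X : C, P X → ∃ (L : C) (c : X ⟶ L), Injective L ∧ Mono c ∧ P L) (n : ℕ) :
    ∀ {S : ShortComplex C}, S.ShortExact → P S.X₃ → Epi (F.map S.g) →
      Nonempty ((F.rightDerived (n + 1)).obj S.X₁ ≅ (F.rightDerived (n + 1)).obj S.X₂) := by
  induction n with
  | zero =>
    intro S hS hP hg
    obtain ⟨L, c, _, _, hL⟩ := hinj _ hP
    obtain ⟨S', p, -, -, -, -, -, δ, f, w, w', h₁, h₂, hf⟩ :=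
      exists_shortExact_rightDerived F hS c (fun p _ => hepi p hL)
    -- The connecting map kills the image of `F.map S.g`, which is everything.
    have hδ : δ = 0 := by rw [← cancel_epi (F.map S.g), w, comp_zero]
    have : Mono f := h₂.mono_g hδ
    have : IsIso f := isIso_of_mono_of_epi f
    exact ⟨asIso f⟩
  | succ n ih =>
    intro S hS hP hg
    obtain ⟨L, c, _, _, hL⟩ := hinj _ hP
    obtain ⟨S', p, hS', _, hg', h₁, h₂, -⟩ :=
      exists_shortExact_rightDerived F hS c (fun p _ => hepi p hL)
    obtain ⟨e⟩ := ih hS' (hquot p hL) hg'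
    exact ⟨(h₁ n).some ≪≫ e ≪≫ (h₂ n).some.symm⟩

/-- The derived functors of degree at least two do not distinguish the first two terms of a short
exact sequence whose third term is in `P`. -/
theorem nonempty_rightDerived_add_two_iso (P : C → Prop)
    (hquot : ∀ {X Y : C} (p : X ⟶ Y) [Epi p], P X → P Y)
    (hepi : ∀ {X Y : C} (p : X ⟶ Y) [Epi p], P X → Epi (F.map p))
    (hinj : ∀ X : C, P X → ∃ (L : C) (c : X ⟶ L), Injective L ∧ Mono c ∧ P L) (n : ℕ)
    {S : ShortComplex C} (hS : S.ShortExact) (hP : P S.X₃) :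
    Nonempty ((F.rightDerived (n + 2)).obj S.X₁ ≅ (F.rightDerived (n + 2)).obj S.X₂) := by
  obtain ⟨L, c, _, _, hL⟩ := hinj _ hP
  obtain ⟨S', p, hS', _, hg', h₁, h₂, -⟩ :=
    exists_shortExact_rightDerived F hS c (fun p _ => hepi p hL)
  -- After one shift the epimorphism condition holds for `S'` automatically, so none is needed on
  -- `S`.
  obtain ⟨e⟩ := nonempty_rightDerived_iso_of_epi F P hquot hepi hinj n hS' (hquot p hL) hg'
  exact ⟨(h₁ n).some ≪≫ e ≪≫ (h₂ n).some.symm⟩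

end

end CategoryTheory

/-! ### Pointwise exactness and left exactness of `H⁰_𝔪` -/

namespace FIMod

variable {k : Type u} [Ring k]

/-- A sequence of `FI`-modules that is exact is exact at every finite set. -/
theorem exact_app {S : ShortComplex (FIMod k)} (hS : S.Exact) {X : FI} (x : S.X₂.obj X)
    (hx : S.g.app X x = 0) : ∃ y, S.f.app X y = x :=
  (ShortComplex.moduleCat_exact_iff _).1 (hS.map ((evaluation FI (ModuleCat.{u} k)).obj X)) x hx

/-- A sequence of `FI`-modules that is exact at every finite set is exact. -/
theorem exact_of_app {S : ShortComplex (FIMod k)}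
    (h : ∀ (X : FI) (x : S.X₂.obj X), S.g.app X x = 0 → ∃ y, S.f.app X y = x) : S.Exact := by
  rw [ShortComplex.exact_iff_isZero_homology]
  refine Functor.isZero _ fun X => ?_
  refine IsZero.of_iso ?_ (S.mapHomologyIso ((evaluation FI (ModuleCat.{u} k)).obj X)).symm
  rw [← ShortComplex.exact_iff_isZero_homology]
  exact (ShortComplex.moduleCat_exact_iff _).2 (h X)

theorem mono_iff_injective {V W : FIMod k} (φ : V ⟶ W) :
    Mono φ ↔ ∀ S, Function.Injective (φ.app S) := by
  simp only [NatTrans.mono_iff_mono_app, ModuleCat.mono_iff_injective]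

theorem epi_iff_surjective {V W : FIMod k} (φ : V ⟶ W) :
    Epi φ ↔ ∀ S, Function.Surjective (φ.app S) := by
  simp only [NatTrans.epi_iff_epi_app, ModuleCat.epi_iff_surjective]

theorem map_app {V W : FIMod k} (φ : V ⟶ W) {S T : FI} (f : S ⟶ T) (x : V.obj S) :
    φ.app T (V.map f x) = W.map f (φ.app S x) := by
  rw [← ModuleCat.comp_apply, ← ModuleCat.comp_apply, φ.naturality]

instance torsion_preservesFiniteLimits : PreservesFiniteLimits (torsion k) := by
  rw [Functor.preservesFiniteLimits_iff_forall_exact_map_and_mono]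
  intro S hS
  have hinj := (mono_iff_injective _).1 hS.mono_f
  constructor
  · refine exact_of_app fun X x hx => ?_
    obtain ⟨y, hy⟩ := exact_app hS.exact x.1 (congrArg Subtype.val hx)
    obtain ⟨T, f, hf⟩ := x.2
    -- The preimage `y` is torsion: the injection that kills its image kills `y`, by injectivity at
    -- `T`.
    refine ⟨⟨y, T, f, hinj T ?_⟩, Subtype.ext hy⟩
    rw [map_app, hy, hf, map_zero]
  · exact (mono_iff_injective _).2 fun X x y h => Subtype.ext (hinj X (congrArg Subtype.val h))

/-! ### Modules that vanish on large sets -/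

/-- The `FI`-module `V` vanishes on all finite sets with at least `N` elements. -/
def VanishesFrom (N : ℕ) (V : FIMod k) : Prop :=
  ∀ S : FI, N ≤ S.card → Subsingleton (V.obj S)

theorem VanishesFrom.of_epi {N : ℕ} {V W : FIMod k} (p : V ⟶ W) [Epi p] (hV : VanishesFrom N V) :
    VanishesFrom N W := fun S hS =>
  have := hV S hS
  ((epi_iff_surjective p).1 inferInstance S).subsingleton

/-- Every finite set maps to finite sets with arbitrarily many elements. -/
theorem _root_.FI.exists_hom_card_ge (S : FI) (N : ℕ) : ∃ (T : FI) (_ : S ⟶ T), N ≤ T.card := by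
  let i : S.carrier ↪ S.carrier ⊕ Fin N := ⟨Sum.inl, Sum.inl_injective⟩
  exact ⟨⟨S.carrier ⊕ Fin N⟩, i, by simp [FI.card]⟩

theorem VanishesFrom.mem_torsionSub {N : ℕ} {V : FIMod k} (hV : VanishesFrom N V) {S : FI}
    (x : V.obj S) : x ∈ V.torsionSub.carrier S := by
  obtain ⟨T, f, hT⟩ := S.exists_hom_card_ge N
  have := hV T hT
  exact ⟨T, f, Subsingleton.elim _ _⟩

/-- Any lift of a torsion element of `W` is torsion, since all of `V` is. -/
theorem VanishesFrom.epi_torsion_map {N : ℕ} {V W : FIMod k} (p : V ⟶ W) [Epi p]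
    (hV : VanishesFrom N V) : Epi ((torsion k).map p) := by
  refine (epi_iff_surjective _).2 fun S y => ?_
  obtain ⟨x, hx⟩ := (epi_iff_surjective p).1 inferInstance S y.1
  exact ⟨⟨x, hV.mem_torsionSub x⟩, Subtype.ext hx⟩

/-- An `FI`-module that vanishes on all finite sets with at least `N` elements embeds into an
injective one with the same property. -/
theorem VanishesFrom.exists_injective {N : ℕ} {V : FIMod k} (hV : VanishesFrom N V) :
    ∃ (L : FIMod k) (c : V ⟶ L), Injective L ∧ Mono c ∧ VanishesFrom N L := by
  -- Coinduced modules: `J n` at `S` is a product of copies of an injective module indexed by the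
  -- injections from `S` to an `n`-element set. Only `n < N` is used, so that this index set is
  -- empty once `|S| ≥ N`.
  let J : Fin N → FIMod k := fun n =>
    (evaluationRightAdjoint (ModuleCat.{u} k) (FI.std n)).obj
      (Injective.under (V.obj (FI.std n)))
  have hJ : ∀ n, Injective (J n) := fun n =>
    Injective.injective_of_adjoint (evaluationAdjunctionLeft (ModuleCat.{u} k) (FI.std n)) _
  let ι : ∀ n, V ⟶ J n := fun n =>
    { app S := Pi.lift fun g => V.map g ≫ Injective.ι (V.obj (FI.std n))
      naturality S T f := by
        refine limit.hom_ext fun ⟨g⟩ => ?_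
        refine ((Category.assoc _ _ _).trans (congrArg _ (limit.lift_π _ _))).trans ?_
        refine Eq.trans ?_ ((Category.assoc _ _ _).trans (congrArg _ (limit.lift_π _ _))).symm
        refine Eq.trans ?_ (limit.lift_π (Fan.mk _ fun g : S ⟶ FI.std n =>
          V.map g ≫ Injective.ι (V.obj (FI.std n))) ⟨f ≫ g⟩).symm
        exact (by rw [V.map_comp, Category.assoc] :
          V.map f ≫ V.map g ≫ Injective.ι (V.obj (FI.std n)) =
            V.map (f ≫ g) ≫ Injective.ι (V.obj (FI.std n))) }
  refine ⟨∏ᶜ J, Pi.lift ι, inferInstance, ?_, fun S hS => ?_⟩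
  · have : ∀ S, Mono ((Pi.lift ι).app S) := by
      intro S
      by_cases hS : N ≤ S.card
      · have := hV S hS
        exact (ModuleCat.mono_iff_injective _).2 fun x y _ => Subsingleton.elim x y
      · let n : Fin N := ⟨S.card, not_le.1 hS⟩
        obtain ⟨e⟩ := S.exists_iso_std
        have h₁ : (Pi.lift ι).app S ≫ (Pi.π J n).app S = (ι n).app S := by
          rw [← NatTrans.comp_app, Pi.lift_π]
        -- For `|S| = n < N`, the factor indexed by a bijection already detects all of `V_S`.
        have h₂ : (ι n).app S ≫ Pi.π (fun _ : S ⟶ FI.std n => Injective.under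
            (V.obj (FI.std n))) e.hom = V.map e.hom ≫ Injective.ι (V.obj (FI.std n)) :=
          limit.lift_π (Fan.mk _ fun g : S ⟶ FI.std n => V.map g ≫
            Injective.ι (V.obj (FI.std n))) ⟨e.hom⟩
        have h₃ : Mono ((ι n).app S ≫ Pi.π (fun _ : S ⟶ FI.std n => Injective.under
            (V.obj (FI.std n))) e.hom) := by
          rw [h₂]
          exact mono_comp _ _
        have h₄ : Mono ((Pi.lift ι).app S ≫ (Pi.π J n).app S) := by
          rw [h₁]
          exact mono_of_mono _ (Pi.π (fun _ : S ⟶ FI.std n => Injective.under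
            (V.obj (FI.std n))) e.hom)
        exact mono_of_mono _ ((Pi.π J n).app S)
    exact NatTrans.mono_of_mono_app _
  · refine ModuleCat.subsingleton_of_isZero ((IsZero.iff_id_eq_zero _).2 ?_)
    refine (isLimitOfPreserves ((evaluation FI (ModuleCat.{u} k)).obj S)
      (productIsProduct J)).hom_ext fun ⟨n⟩ => ?_
    have hz : IsZero ((J n).obj S) := by
      refine (IsZero.iff_id_eq_zero _).2 (limit.hom_ext fun ⟨g⟩ => ?_)
      have h : S.card ≤ n := (FI.card_le g).trans_eq (FI.card_std n)
      exact absurd (hS.trans h) (not_le.2 n.2)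
    exact hz.eq_of_tgt _ _

/-! ### The truncation sequence -/

/-- The inclusion of the truncation `V_{≥ N}` in `V`. -/
noncomputable def truncι (V : FIMod k) (N : ℕ) : V.trunc N ⟶ V where
  app S := ModuleCat.ofHom ((V.truncSub N).carrier S).subtype
  naturality _ _ _ := rfl

instance (V : FIMod k) (N : ℕ) : Mono (V.truncι N) :=
  (mono_iff_injective _).2 fun _ => Subtype.val_injective

theorem truncι_app_surjective (V : FIMod k) {N : ℕ} {S : FI} (hS : N ≤ S.card) :
    Function.Surjective ((V.truncι N).app S) := fun x =>
  ⟨⟨x, by simp [truncSub, hS]⟩, rfl⟩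

/-- The short exact sequence `0 → V_{≥ N} → V → V / V_{≥ N} → 0`. -/
noncomputable abbrev truncShortComplex (V : FIMod k) (N : ℕ) : ShortComplex (FIMod k) :=
  ShortComplex.mk (V.truncι N) (cokernel.π (V.truncι N)) (cokernel.condition _)

theorem truncShortComplex_shortExact (V : FIMod k) (N : ℕ) :
    (V.truncShortComplex N).ShortExact where
  exact := ShortComplex.exact_cokernel _

theorem vanishesFrom_cokernel_truncι (V : FIMod k) (N : ℕ) :
    VanishesFrom N (cokernel (V.truncι N)) := by
  intro S hS
  refine subsingleton_of_forall_eq 0 fun y => ?_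
  obtain ⟨x, rfl⟩ := (epi_iff_surjective (cokernel.π (V.truncι N))).1 inferInstance S y
  obtain ⟨z, rfl⟩ := V.truncι_app_surjective hS x
  rw [← ModuleCat.comp_apply, ← NatTrans.comp_app, cokernel.condition]
  rfl

/-! ### Comparison of degrees -/

/-- The floor `-1` is inherited from `W.degree`, so `d` is only used to restrict to sets of size
greater than `d`. -/
theorem degree_le_max {V W : FIMod k} {d : WithTop ℤ}
    (h : ∀ S : FI, d < ((S.card : ℤ) : WithTop ℤ) → Subsingleton (W.obj S) →
      Subsingleton (V.obj S)) : V.degree ≤ max W.degree d := by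
  have hW := (degree_le_iff W W.degree).1 le_rfl
  exact (degree_le_iff _ _).2 ⟨hW.1.trans (le_max_left _ _), fun S hS =>
    h S ((le_max_right _ _).trans_lt hS) (hW.2 S ((le_max_left _ _).trans_lt hS))⟩

theorem degree_mono {V W : FIMod k}
    (h : ∀ S : FI, Subsingleton (W.obj S) → Subsingleton (V.obj S)) : V.degree ≤ W.degree := by
  have hW := (degree_le_iff W W.degree).1 le_rfl
  exact (degree_le_iff _ _).2 ⟨hW.1, fun S hS => h S (hW.2 S hS)⟩

theorem degree_le_of_mono {V W : FIMod k} (φ : V ⟶ W) [Mono φ] : V.degree ≤ W.degree :=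
  degree_mono fun S _ => ((mono_iff_injective φ).1 inferInstance S).subsingleton

theorem degree_le_of_epi {V W : FIMod k} (φ : V ⟶ W) [Epi φ] : W.degree ≤ V.degree :=
  degree_mono fun S _ => ((epi_iff_surjective φ).1 inferInstance S).subsingleton

theorem degree_eq_of_iso {V W : FIMod k} (e : V ≅ W) : V.degree = W.degree :=
  le_antisymm (degree_le_of_mono e.hom) (degree_le_of_mono e.inv)

theorem le_card_of_sub_one_lt {N : ℕ} {S : FI}
    (h : (((N : ℤ) - 1 : ℤ) : WithTop ℤ) < ((S.card : ℤ) : WithTop ℤ)) : N ≤ S.card := by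
  have := WithTop.coe_lt_coe.1 h
  omega

theorem locohDegree_zero (V : FIMod k) : locohDegree 0 V = ((torsion k).obj V).degree :=
  degree_eq_of_iso ((torsion k).rightDerivedZeroIsoSelf.app V)

theorem locohDegree_trunc_eq (V : FIMod k) (N n : ℕ) :
    locohDegree (n + 2) V = locohDegree (n + 2) (V.trunc N) := by
  obtain ⟨e⟩ := nonempty_rightDerived_add_two_iso (torsion k) (VanishesFrom N)
    (fun p _ h => h.of_epi p) (fun p _ h => h.epi_torsion_map p) (fun _ h => h.exists_injective) n
    (V.truncShortComplex_shortExact N) (V.vanishesFrom_cokernel_truncι N)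
  exact (degree_eq_of_iso e).symm

theorem locohDegree_one_trunc (V : FIMod k) (N : ℕ) :
    locohDegree 1 V ≤ locohDegree 1 (V.trunc N) ∧
      locohDegree 1 (V.trunc N) ≤
        max (locohDegree 1 V) (((N : ℤ) - 1 : ℤ) : WithTop ℤ) := by
  have hQ := V.vanishesFrom_cokernel_truncι N
  obtain ⟨L, c, _, _, hL⟩ := hQ.exists_injective
  obtain ⟨-, -, -, -, -, -, -, δ, f, w, w', h₁, h₂, hf⟩ :=
    exists_shortExact_rightDerived (torsion k) (V.truncShortComplex_shortExact N) c
      (fun p _ => hL.epi_torsion_map p)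
  -- The surjection `f` gives the first bound. For the second, an element over `S` with `|S| ≥ N`
  -- and `H¹(V)_S = 0` comes from `H⁰(Q)_S`, which is zero because `Q_S` is.
  refine ⟨@degree_le_of_epi _ _ _ _ f hf, degree_le_max fun S hS hV => ?_⟩
  refine subsingleton_of_forall_eq 0 fun x => ?_
  obtain ⟨y, rfl⟩ := exact_app h₂ x (Subsingleton.elim (α := ((locoh k 1).obj V).obj S) _ _)
  have := hQ S (le_card_of_sub_one_lt hS)
  have hy : y = 0 := Subtype.ext (Subsingleton.elim _ _)
  exact (congrArg (δ.app S) hy).trans (map_zero (δ.app S).hom)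

/-- Left exactness embeds `H⁰(V_{≥ N})` in `H⁰(V)`, and this embedding is onto at every set where `V
/ V_{≥ N}` vanishes. -/
theorem locohDegree_zero_trunc (V : FIMod k) (N : ℕ) :
    locohDegree 0 (V.trunc N) ≤ locohDegree 0 V ∧
      locohDegree 0 V ≤
        max (locohDegree 0 (V.trunc N)) (((N : ℤ) - 1 : ℤ) : WithTop ℤ) := by
  rw [locohDegree_zero, locohDegree_zero]
  have h := (Functor.preservesFiniteLimits_iff_forall_exact_map_and_mono (torsion k)).1
    inferInstance _ (V.truncShortComplex_shortExact N)
  refine ⟨have := h.2; degree_le_of_mono ((torsion k).map (V.truncι N)),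
    degree_le_max fun S hS hV => ?_⟩
  have := V.vanishesFrom_cokernel_truncι N S (le_card_of_sub_one_lt hS)
  refine subsingleton_of_forall_eq 0 fun x => ?_
  obtain ⟨y, rfl⟩ := exact_app h.1 x (Subtype.ext (Subsingleton.elim _ _))
  have hy : y = 0 := Subsingleton.elim (α := ((torsion k).obj (V.trunc N)).obj S) _ _
  exact (congrArg (((torsion k).map (V.truncι N)).app S) hy).trans
    (map_zero (((torsion k).map (V.truncι N)).app S).hom)

end FIMod

theorem mainTheorem9 (k : Type u) [Ring k] (V : FIMod k) (N : ℕ) :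
    (FIMod.locohDegree 0 (V.trunc N) ≤ FIMod.locohDegree 0 V ∧
      FIMod.locohDegree 0 V ≤
        max (FIMod.locohDegree 0 (V.trunc N)) (((N : ℤ) - 1 : ℤ) : WithTop ℤ)) ∧
    (FIMod.locohDegree 1 V ≤ FIMod.locohDegree 1 (V.trunc N) ∧
      FIMod.locohDegree 1 (V.trunc N) ≤
        max (((N : ℤ) - 1 : ℤ) : WithTop ℤ) (FIMod.locohDegree 1 V)) ∧
    ∀ j : ℕ, 2 ≤ j → FIMod.locohDegree j V = FIMod.locohDegree j (V.trunc N) := by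
  refine ⟨V.locohDegree_zero_trunc N, ?_, fun j hj => ?_⟩
  · rw [max_comm]
    exact V.locohDegree_one_trunc N
  · obtain ⟨n, rfl⟩ := Nat.exists_eq_add_of_le' hj
    exact V.locohDegree_trunc_eq N n
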